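/- Let $\Gamma$ be a group with a finite generating set $X$. For $g\in\Gamma$ put $D_\Gamma(g)=\min\{[\Gamma:\Delta] : \Delta\lhd\Gamma,\ g\notin\Delta\}\in\mathbf N\cup\{\infty\}$, and for $n\ge 0$ put $F_{\Gamma,X}(n)=\max\{D_\Gamma(g) : g\neq 1,\ g \text{ is a product of at most } n \text{ elements of } X\cup X^{-1}\}\in\mathbf N\cup\{\infty\}$ (with $\max\emptyset=0$, $\log 0=-\infty$, $\log\infty=\infty$). Then: (1) If $$\limsup_{n\to\infty}\frac{(\log F_{\Gamma,X}(n))^2}{\log\log n}=0,$$ then $\Gamma$ is finite. (2) If $\Gamma$ is infinite, then $e^{\sqrt{\log\log n}}\preceq F_{\Gamma,X}(n)$; that is, there is a positive integer $C$ (which may depend on $\Gamma$ and $X$) such that $e^{\sqrt{\log\log n}}\le C\,F_{\Gamma,X}(Cn)$ for all integers $n\ge 1$, where for $n=1,2$ the left-hand side is read as $1$. -/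

import Mathlib

open scoped ENNReal

/-- The closed ball of radius `n` about the identity in the word metric of `Γ` given by `X`:
products of at most `n` elements of `X ∪ X⁻¹`. -/
def wordBall {Γ : Type*} [Group Γ] (X : Finset Γ) (n : ℕ) : Set Γ :=
  {g | ∃ l : List Γ, l.length ≤ n ∧ (∀ x ∈ l, x ∈ X ∨ x⁻¹ ∈ X) ∧ l.prod = g}

/-- The normal divisibility function
`D_Γ(g) = min {[Γ : Δ] : Δ ◁ Γ, g ∉ Δ}`, with values in `ℕ ∪ {∞}`
(it is `∞` precisely when no normal subgroup of finite index avoids `g`). -/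
noncomputable def normalDivisibility {Γ : Type*} [Group Γ] (g : Γ) : ℕ∞ :=
  ⨅ (Δ : Subgroup Γ) (_ : Δ.Normal) (_ : g ∉ Δ), ENat.card (Γ ⧸ Δ)

/-- The function `F_{Γ,X}(n) = max {D_Γ(g) : g in the n-ball, g ≠ 1}`
(the value is `0` if there is no such `g`). -/
noncomputable def farb {Γ : Type*} [Group Γ] (X : Finset Γ) (n : ℕ) : ℕ∞ :=
  ⨆ g ∈ wordBall X n \ {1}, normalDivisibility g

/-- `f ≼ g`: there is a constant `C > 0` such that `f(n) ≤ C g(C n)` for all `n ≥ 1`. -/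
def GrowthLE (f g : ℕ → ℝ≥0∞) : Prop :=
  ∃ C : ℕ, 0 < C ∧ ∀ n : ℕ, 1 ≤ n → f n ≤ (C : ℝ≥0∞) * g (C * n)

open scoped Pointwise
open scoped commutatorElement

/-! ### Product sets: word diameter of finite quotients and Schreier generators. -/

section Balls

variable {A : Type*} [Group A]

/-! If `Γ` is infinite, some nontrivial word of length at most 2^(c m³) lies in every normal
subgroup of index at most `m`. Hence F(n) grows at least like (log n)^(1/3), far above e^√(log log
n), and both claims follow (`succ_le_farb`).

There are at most (m!)^|X| such subgroups `N`, so 2^t with t of order m² suffices. Start from K = Γ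
and repeatedly replace `K` by the intersection of maximal normal subgroups of `K`, one above each N
∩ K ≠ K. Each index [K : N ∩ K] > 1 drops strictly, so after `m` rounds `K` lies in every `N`
(`exists_smaller_subgroup`). It still has finite index, so it is nontrivial.

By Schreier, a round multiplies the length of generators by 2D + 1, where `D` is the diameter of `K`
modulo the intersection. The crux is that D is 2^O(t) (`exists_short_of_isMaximalNormal`): abelian
quotients are handled together, and nonabelian simple ones are corrected one at a time by short
elements trivial in all other factors. Such elements come from iterated commutators
(`exists_short_separating`), whose depth is only logarithmic in the number of factors. -/

lemma inv_mem_set_pow {Y : Set A} (hinv : Y⁻¹ = Y) {n : ℕ} {a : A} (ha : a ∈ Y ^ n) :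
    a⁻¹ ∈ Y ^ n := by
  rw [← hinv, inv_pow]
  simpa using ha

lemma set_pow_subset_subgroup {C : Set A} {N : Subgroup A} (h : C ⊆ N) (n : ℕ) :
    C ^ n ⊆ (N : Set A) := by
  induction n with
  | zero => simp [N.one_mem]
  | succ n ih =>
    rw [pow_succ]
    rintro _ ⟨a, ha, b, hb, rfl⟩
    exact N.mul_mem (ih ha) (h hb)

/-- In a group of order at most `m`, every element is a product of `m` elements of a
symmetric generating set containing `1`. -/
lemma set_pow_eq_univ_of_card_le [Finite A] {Y : Set A} (h1 : 1 ∈ Y) (hinv : Y⁻¹ = Y)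
    (hgen : Subgroup.closure Y = ⊤) {m : ℕ} (hm : Nat.card A ≤ m) : Y ^ m = Set.univ := by
  classical
  have := Fintype.ofFinite A
  -- The cardinality of the powers of `Y` is constant from exponent |A| on, so the nested powers are
  -- constant from `m` on.
  have hc : Y ^ (m + 1) = Y ^ m := by
    refine (Set.eq_of_subset_of_card_le (Set.pow_subset_pow_right h1 m.le_succ) ?_).symm
    rw [Nat.card_eq_fintype_card] at hm
    rw [Group.card_pow_eq_card_pow_card_univ Y m hm,
      Group.card_pow_eq_card_pow_card_univ Y (m + 1) (by omega)]
  refine Set.eq_univ_of_forall fun x ↦ ?_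
  have hx : x ∈ Subgroup.closure Y := by rw [hgen]; trivial
  have key : ∀ y ∈ Y, ∀ z ∈ Y ^ m, y * z ∈ Y ^ m := fun y hy z hz ↦ by
    rw [← hc, pow_succ']
    exact Set.mul_mem_mul hy hz
  induction hx using Subgroup.closure_induction_left with
  | one => exact Set.one_mem_pow h1
  | mul_left y hy z hz ih => exact key y hy z ih
  | inv_mul_cancel y hy z hz ih => exact key _ (by rw [← hinv]; simpa using hy) z ih

lemma closure_image_mk_eq_top {Y : Set A} (hgen : Subgroup.closure Y = ⊤)
    (M : Subgroup A) [M.Normal] : Subgroup.closure (QuotientGroup.mk' M '' Y) = ⊤ := by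
  rw [← MonoidHom.map_closure, hgen, ← MonoidHom.range_eq_map]
  exact MonoidHom.range_eq_top.2 (QuotientGroup.mk'_surjective M)

lemma exists_mem_pow_of_quotient {C : Set A} {M : Subgroup A} [M.Normal] {n : ℕ}
    (h : (QuotientGroup.mk' M '' C) ^ n = Set.univ) (x : A) : ∃ a ∈ C ^ n, a⁻¹ * x ∈ M := by
  have hx : QuotientGroup.mk' M x ∈ (QuotientGroup.mk' M '' C) ^ n := by rw [h]; trivial
  rw [← Set.image_pow] at hx
  obtain ⟨a, ha, hax⟩ := hx
  exact ⟨a, ha, QuotientGroup.eq.1 hax⟩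

lemma one_mem_image {B : Type*} [Group B] (f : A →* B) {Y : Set A} (h1 : 1 ∈ Y) :
    1 ∈ f '' Y := ⟨1, h1, map_one f⟩

lemma image_inv_eq {B : Type*} [Group B] (f : A →* B) {Y : Set A} (hinv : Y⁻¹ = Y) :
    (f '' Y)⁻¹ = f '' Y := by
  conv_rhs => rw [← hinv]
  exact (Set.image_inv f Y).symm

lemma exists_mem_pow_of_index_le {Y : Set A} (h1 : 1 ∈ Y) (hinv : Y⁻¹ = Y)
    (hgen : Subgroup.closure Y = ⊤) {M : Subgroup A} (hN : M.Normal) {m : ℕ}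
    (h0 : M.index ≠ 0) (hm : M.index ≤ m) (x : A) : ∃ a ∈ Y ^ m, a⁻¹ * x ∈ M := by
  have : M.FiniteIndex := ⟨h0⟩
  exact exists_mem_pow_of_quotient (set_pow_eq_univ_of_card_le (one_mem_image _ h1)
    (image_inv_eq _ hinv) (closure_image_mk_eq_top hgen M) hm) x

/-- Short generators of a subgroup whose cosets have short representatives. -/
lemma closure_inter_pow_eq {Y : Set A} (h1 : 1 ∈ Y) (hinv : Y⁻¹ = Y)
    (hgen : Subgroup.closure Y = ⊤) {H : Subgroup A} {D : ℕ}
    (hD : ∀ x, ∃ a ∈ Y ^ D, a⁻¹ * x ∈ H) :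
    Subgroup.closure ((H : Set A) ∩ Y ^ (2 * D + 1)) = H := by
  set E := Subgroup.closure ((H : Set A) ∩ Y ^ (2 * D + 1)) with hE
  have hEH : E ≤ H := by
    rw [hE, Subgroup.closure_le]
    exact Set.inter_subset_left
  -- Schreier's argument: the correction b⁻¹ya lies in `H` and has length D + 1 + D.
  have key : ∀ y ∈ Y, ∀ z, (∃ a ∈ Y ^ D, a⁻¹ * z ∈ E) → ∃ a ∈ Y ^ D, a⁻¹ * (y * z) ∈ E := by
    rintro y hy z ⟨a, ha, haz⟩
    obtain ⟨b, hb, hby⟩ := hD (y * a)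
    refine ⟨b, hb, ?_⟩
    have : b⁻¹ * (y * a) ∈ E := by
      refine Subgroup.subset_closure ⟨hby, ?_⟩
      rw [show 2 * D + 1 = D + (1 + D) by ring, pow_add, pow_add, pow_one]
      exact Set.mul_mem_mul (inv_mem_set_pow hinv hb) (Set.mul_mem_mul hy ha)
    convert E.mul_mem this haz using 1
    group
  have hall : ∀ x, ∃ a ∈ Y ^ D, a⁻¹ * x ∈ E := by
    intro x
    have hx : x ∈ Subgroup.closure Y := by rw [hgen]; trivial
    induction hx using Subgroup.closure_induction_left with
    | one => exact ⟨1, Set.one_mem_pow h1, by simp⟩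
    | mul_left y hy z hz ih => exact key y hy z ih
    | inv_mul_cancel y hy z hz ih => exact key _ (by rw [← hinv]; simpa using hy) z ih
  refine le_antisymm hEH fun h hh ↦ ?_
  obtain ⟨a, ha, hah⟩ := hall h
  have haH : a ∈ H := by
    have := H.mul_mem hh (H.inv_mem (hEH hah))
    simpa using this
  have haE : a ∈ E :=
    Subgroup.subset_closure ⟨haH, Set.pow_subset_pow_right h1 (by omega) ha⟩
  simpa using E.mul_mem haE hah

/-- In a finite abelian group of exponent `E`, a symmetric generating set has small diameter. -/
lemma set_pow_eq_univ_of_comm {Q : Type*} [CommGroup Q] [Finite Q] {Y : Set Q} (h1 : 1 ∈ Y)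
    (hgen : Subgroup.closure Y = ⊤) {E : ℕ} (hE0 : 0 < E) (hE : ∀ x : Q, x ^ E = 1) {i : ℕ}
    (hi : Nat.card Q < 2 ^ i) : Y ^ (i * E) = Set.univ := by
  classical
  -- Adjoining a generator outside `H` at least doubles the order and costs at most `E` further
  -- factors.
  have key : ∀ i : ℕ, ∃ H : Subgroup Q, (H = ⊤ ∨ 2 ^ i ≤ Nat.card H) ∧
      (H : Set Q) ⊆ Y ^ (i * E) := by
    intro i
    induction i with
    | zero => exact ⟨⊥, Or.inr (by simp), by simp⟩
    | succ i ih =>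
      obtain ⟨H, hH, hs⟩ := ih
      by_cases htop : H = ⊤
      · exact ⟨H, Or.inl htop, hs.trans (Set.pow_subset_pow_right h1 (by gcongr; omega))⟩
      obtain ⟨y, hy, hyH⟩ : ∃ y ∈ Y, y ∉ H := by
        by_contra! hcon
        exact htop (top_le_iff.1 (hgen ▸ (Subgroup.closure_le H).2 hcon))
      refine ⟨H ⊔ Subgroup.zpowers y, Or.inr ?_, ?_⟩
      · have hcard := hH.resolve_left htop
        have hlt : H < H ⊔ Subgroup.zpowers y := by
          refine lt_of_le_of_ne le_sup_left fun h ↦ hyH ?_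
          rw [h]
          exact (le_sup_right : _ ≤ H ⊔ Subgroup.zpowers y) (Subgroup.mem_zpowers y)
        obtain ⟨k, hk⟩ := Subgroup.card_dvd_of_le hlt.le
        have hk0 : k ≠ 0 := by
          rintro rfl
          exact Nat.card_pos.ne' (hk.trans (mul_zero _))
        have hk1 : k ≠ 1 := by
          rintro rfl
          exact hlt.ne (Subgroup.eq_of_le_of_card_ge hlt.le (by omega))
        rw [hk, pow_succ]
        exact Nat.mul_le_mul hcard (by omega)
      · intro x hx
        obtain ⟨h, hh, z, hz, rfl⟩ := Subgroup.mem_sup.1 hx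
        rw [mem_zpowers_iff_mem_range_orderOf, Finset.mem_image] at hz
        obtain ⟨e, he, rfl⟩ := hz
        rw [add_one_mul, pow_add]
        refine Set.mul_mem_mul (hs hh) (Set.pow_subset_pow_right h1 ?_ (Set.pow_mem_pow hy))
        exact (Finset.mem_range.1 he).le.trans (orderOf_le_of_pow_eq_one hE0 (hE y))
  obtain ⟨H, hH, hs⟩ := key i
  rcases hH with rfl | hH
  · exact Set.univ_subset_iff.1 hs
  · exact absurd (hH.trans (Subgroup.card_le_card_group H)) (by omega)

end Balls

/-! ### Diameter modulo an intersection of maximal normal subgroups. -/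

section MaximalNormal

variable {A : Type*} [Group A]

/-- `M` is maximal among the proper normal subgroups. -/
structure IsMaximalNormal (M : Subgroup A) : Prop where
  normal : M.Normal
  ne_top : M ≠ ⊤
  eq_or_eq_top : ∀ N : Subgroup A, N.Normal → M ≤ N → N = M ∨ N = ⊤

lemma exists_isMaximalNormal_ge {N : Subgroup A} (hN : N.Normal) (h0 : N.index ≠ 0)
    (htop : N ≠ ⊤) : ∃ M, IsMaximalNormal M ∧ N ≤ M := by
  classical
  let P : ℕ → Prop := fun i ↦ ∃ M : Subgroup A, M.Normal ∧ M ≠ ⊤ ∧ N ≤ M ∧ M.index = i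
  have hP : ∃ i, P i := ⟨_, N, hN, htop, le_rfl, rfl⟩
  obtain ⟨M, hM, hMtop, hNM, hi⟩ := Nat.find_spec hP
  refine ⟨M, ⟨hM, hMtop, fun K hK hMK ↦ ?_⟩, hNM⟩
  by_contra! hcon
  have : N.FiniteIndex := ⟨h0⟩
  have : M.FiniteIndex := Subgroup.finiteIndex_of_le hNM
  have hlt := Subgroup.index_strictAnti (lt_of_le_of_ne hMK hcon.1.symm)
  exact Nat.find_min hP (hi ▸ hlt) ⟨K, hK, hcon.2, hNM.trans hMK, rfl⟩

variable {M : Subgroup A}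

/-- The conjugates of an element outside a maximal normal subgroup generate the quotient. -/
lemma IsMaximalNormal.normalClosure_mk [M.Normal] (hM : IsMaximalNormal M) {u : A} (hu : u ∉ M) :
    Subgroup.normalClosure {QuotientGroup.mk' M u} = ⊤ := by
  set R := Subgroup.normalClosure {QuotientGroup.mk' M u} with hR
  have hmem : u ∈ R.comap (QuotientGroup.mk' M) := Subgroup.subset_normalClosure rfl
  have hle : M ≤ R.comap (QuotientGroup.mk' M) := fun x hx ↦ by
    rw [Subgroup.mem_comap, QuotientGroup.mk'_apply, (QuotientGroup.eq_one_iff x).2 hx]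
    exact R.one_mem
  rcases hM.eq_or_eq_top _ inferInstance hle with h | h
  · exact absurd (h ▸ hmem) hu
  · refine eq_top_iff.2 fun q _ ↦ ?_
    obtain ⟨x, rfl⟩ := QuotientGroup.mk'_surjective M q
    exact (h ▸ Subgroup.mem_top x : x ∈ R.comap (QuotientGroup.mk' M))

lemma mk'_eq_one_iff [M.Normal] {x : A} : QuotientGroup.mk' M x = 1 ↔ x ∈ M :=
  QuotientGroup.eq_one_iff x

/-- Otherwise `u` commutes modulo `M` with all conjugates of `v`. These generate A/M, so `u` is
central there; the conjugates of `u` generate too, so A/M would be abelian. -/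
lemma IsMaximalNormal.exists_commutator_notMem (hM : IsMaximalNormal M)
    (hna : ∃ x y : A, ⁅x, y⁆ ∉ M) {u v : A} (hu : u ∉ M) (hv : v ∉ M) :
    ∃ c, ⁅u, c * v * c⁻¹⁆ ∉ M := by
  have := hM.normal
  by_contra! hcon
  have hcent : QuotientGroup.mk' M u ∈ Subgroup.center (A ⧸ M) := by
    rw [← Subgroup.centralizer_univ, ← Subgroup.coe_top, ← hM.normalClosure_mk hv,
      Subgroup.normalClosure, Subgroup.centralizer_closure, Subgroup.mem_centralizer_iff]
    intro q hq
    obtain ⟨_, rfl, hq⟩ := Group.mem_conjugatesOfSet_iff.1 hq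
    obtain ⟨d, rfl⟩ := isConj_iff.1 hq
    obtain ⟨c, rfl⟩ := QuotientGroup.mk'_surjective M d
    have h := mk'_eq_one_iff.2 (hcon c)
    rw [map_commutatorElement, commutatorElement_eq_one_iff_mul_comm] at h
    simpa only [map_mul, map_inv] using h.symm
  have hle : Subgroup.normalClosure {QuotientGroup.mk' M u} ≤ Subgroup.center (A ⧸ M) :=
    Subgroup.normalClosure_le_normal (by simpa using hcent)
  rw [hM.normalClosure_mk hu] at hle
  obtain ⟨x, y, hxy⟩ := hna
  refine hxy (mk'_eq_one_iff.1 ?_)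
  rw [map_commutatorElement, commutatorElement_eq_one_iff_mul_comm]
  exact (Subgroup.mem_center_iff.1 (hle (Subgroup.mem_top (QuotientGroup.mk' M x))) _).symm

variable {Y : Set A}

lemma commutator_conj_mem_pow (hinv : Y⁻¹ = Y) {L m : ℕ} {u v c : A} (hu : u ∈ Y ^ L)
    (hv : v ∈ Y ^ L) (hc : c ∈ Y ^ m) : ⁅u, c * v * c⁻¹⁆ ∈ Y ^ (4 * L + 4 * m) := by
  have hc' := inv_mem_set_pow hinv hc
  have hu' := inv_mem_set_pow hinv hu
  have hv' := inv_mem_set_pow hinv hv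
  have h : ⁅u, c * v * c⁻¹⁆ = u * (c * v * c⁻¹) * u⁻¹ * (c * v⁻¹ * c⁻¹) := by
    rw [commutatorElement_def]
    group
  rw [h, show 4 * L + 4 * m = L + (m + L + m) + L + (m + L + m) by ring]
  simp only [pow_add]
  exact Set.mul_mem_mul (Set.mul_mem_mul (Set.mul_mem_mul hu
    (Set.mul_mem_mul (Set.mul_mem_mul hc hv) hc')) hu')
    (Set.mul_mem_mul (Set.mul_mem_mul hc hv') hc')

/-- A short element which avoids a given maximal normal subgroup with nonabelian quotient and lies
in many other ones. -/
lemma exists_short_separating (h1 : 1 ∈ Y) (hinv : Y⁻¹ = Y) (hgen : Subgroup.closure Y = ⊤)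
    {m : ℕ} (hM : IsMaximalNormal M) (hM0 : M.index ≠ 0) (hMm : M.index ≤ m)
    (hna : ∃ x y : A, ⁅x, y⁆ ∉ M) (t : ℕ) (J : Finset (Subgroup A))
    (hJ : ∀ N ∈ J, IsMaximalNormal N ∧ N.index ≠ 0 ∧ N.index ≤ m) (hMJ : M ∉ J)
    (hcard : J.card ≤ 2 ^ t) : ∃ u ∈ Y ^ (8 ^ t * m ^ 2), u ∉ M ∧ ∀ N ∈ J, u ∈ N := by
  classical
  have hm1 : 1 ≤ m := (Nat.one_le_iff_ne_zero.2 hM0).trans hMm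
  have hmm : m ≤ m ^ 2 := Nat.le_self_pow two_ne_zero m
  have := hM.normal
  induction t generalizing J with
  | zero =>
    rw [pow_zero, one_mul]
    rw [pow_zero] at hcard
    rcases Nat.le_one_iff_eq_zero_or_eq_one.1 hcard with h | h
    · obtain rfl := Finset.card_eq_zero.1 h
      obtain ⟨x, hx⟩ : ∃ x, x ∉ M := by
        by_contra! hcon
        exact hM.ne_top (eq_top_iff.2 fun x _ ↦ hcon x)
      obtain ⟨a, ha, hax⟩ := exists_mem_pow_of_index_le h1 hinv hgen hM.normal hM0 hMm x
      refine ⟨a, Set.pow_subset_pow_right h1 hmm ha, fun haM ↦ hx ?_, by simp⟩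
      simpa using M.mul_mem haM hax
    · obtain ⟨N, rfl⟩ := Finset.card_eq_one.1 h
      obtain ⟨hN, hN0, hNm⟩ := hJ N (Finset.mem_singleton_self N)
      have := hN.normal
      obtain ⟨x, hxN, hxM⟩ : ∃ x ∈ N, x ∉ M := by
        by_contra! hcon
        rcases hN.eq_or_eq_top M hM.normal hcon with h | h
        · exact hMJ (by simp [h])
        · exact hM.ne_top h
      have hle : (N ⊓ M).index ≤ m ^ 2 :=
        Subgroup.index_inf_le.trans (by rw [sq]; exact Nat.mul_le_mul hNm hMm)
      obtain ⟨a, ha, hax⟩ := exists_mem_pow_of_index_le h1 hinv hgen (M := N ⊓ M)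
        inferInstance (Subgroup.index_inf_ne_zero hN0 hM0) hle x
      refine ⟨a, ha, fun haM ↦ hxM (by simpa using M.mul_mem haM hax.2), ?_⟩
      intro N' hN'
      rw [Finset.mem_singleton.1 hN']
      have := N.mul_mem hxN (N.inv_mem hax.1)
      simpa using this
  | succ t ih =>
    -- Split `J` into halves: `u` dies on one, `v` on the other, so a commutator of `u` with a
    -- conjugate of `v` dies on both.
    obtain ⟨J₁, hJ₁, hc₁⟩ := Finset.exists_subset_card_eq (min_le_right (2 ^ t) J.card)
    obtain ⟨u, hu, huM, huJ⟩ := ih J₁ (fun N hN ↦ hJ N (hJ₁ hN)) (fun h ↦ hMJ (hJ₁ h))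
      (hc₁.trans_le (min_le_left _ _))
    obtain ⟨v, hv, hvM, hvJ⟩ := ih (J \ J₁) (fun N hN ↦ hJ N (Finset.sdiff_subset hN))
      (fun h ↦ hMJ (Finset.sdiff_subset h)) (by
        rw [Finset.card_sdiff_of_subset hJ₁, hc₁]
        rw [pow_succ] at hcard
        omega)
    obtain ⟨d, hd⟩ := hM.exists_commutator_notMem hna huM hvM
    obtain ⟨c, hc, hcd⟩ := exists_mem_pow_of_index_le h1 hinv hgen hM.normal hM0 hMm d
    refine ⟨⁅u, c * v * c⁻¹⁆, Set.pow_subset_pow_right h1 ?_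
      (commutator_conj_mem_pow hinv hu hv hc), fun hmem ↦ hd ?_, fun N hN ↦ ?_⟩
    -- With L = 8^t m² ≥ m, the commutator has length at most 4L + 4m ≤ 8L.
    · have : m ≤ 8 ^ t * m ^ 2 := hmm.trans (Nat.le_mul_of_pos_left _ (by positivity))
      rw [pow_succ 8 t]
      linarith
    · have hcd' : QuotientGroup.mk' M c = QuotientGroup.mk' M d := QuotientGroup.eq.2 hcd
      rw [← mk'_eq_one_iff] at hmem ⊢
      simpa only [map_commutatorElement, map_mul, map_inv, hcd'] using hmem
    · have hNn := (hJ N hN).1.normal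
      rw [commutatorElement_def]
      by_cases hN1 : N ∈ J₁
      · have huN := huJ N hN1
        rw [mul_assoc, mul_assoc]
        refine N.mul_mem huN ?_
        rw [← mul_assoc]
        exact hNn.conj_mem _ (N.inv_mem huN) _
      · have hvN := hNn.conj_mem _ (hvJ N (Finset.mem_sdiff.2 ⟨hN, hN1⟩)) c
        exact N.mul_mem (hNn.conj_mem _ hvN u) (N.inv_mem hvN)

/-- Short elements changing the class modulo one maximal normal subgroup at will, without changing
the classes modulo the others. -/
lemma exists_short_correction (h1 : 1 ∈ Y) (hinv : Y⁻¹ = Y) (hgen : Subgroup.closure Y = ⊤)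
    {m t : ℕ} (hM : IsMaximalNormal M) (hM0 : M.index ≠ 0) (hMm : M.index ≤ m)
    (hna : ∃ x y : A, ⁅x, y⁆ ∉ M) (J : Finset (Subgroup A))
    (hJ : ∀ N ∈ J, IsMaximalNormal N ∧ N.index ≠ 0 ∧ N.index ≤ m) (hMJ : M ∉ J)
    (hcard : J.card ≤ 2 ^ t) (x : A) :
    ∃ b ∈ Y ^ ((2 * m + 8 ^ t * m ^ 2) * m), b⁻¹ * x ∈ M ∧ ∀ N ∈ J, b ∈ N := by
  obtain ⟨u, hu, huM, huJ⟩ := exists_short_separating h1 hinv hgen hM hM0 hMm hna t J hJ hMJ hcard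
  have := hM.normal
  have : M.FiniteIndex := ⟨hM0⟩
  -- Short conjugates of `u` and its inverse: they generate modulo `M` yet lie in every member of
  -- `J`.
  set C : Set A := {x | ∃ c ∈ Y ^ m, ∃ v, (v = 1 ∨ v = u ∨ v = u⁻¹) ∧ x = c * v * c⁻¹} with hC
  have h1C : 1 ∈ C := ⟨1, Set.one_mem_pow h1, 1, Or.inl rfl, by simp⟩
  have hCinv : C⁻¹ = C := by
    have hsub : C⁻¹ ⊆ C := by
      rintro z ⟨c, hc, v, hv, hz⟩
      refine ⟨c, hc, v⁻¹, ?_, ?_⟩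
      · rcases hv with rfl | rfl | rfl <;> simp
      · rw [← inv_inv z, hz]
        group
    exact hsub.antisymm (by simpa using Set.inv_subset_inv.2 hsub)
  have hCgen : Subgroup.closure (QuotientGroup.mk' M '' C) = ⊤ := by
    rw [eq_top_iff, ← hM.normalClosure_mk huM, Subgroup.normalClosure]
    refine Subgroup.closure_mono fun q hq ↦ ?_
    obtain ⟨_, rfl, hq⟩ := Group.mem_conjugatesOfSet_iff.1 hq
    obtain ⟨d, rfl⟩ := isConj_iff.1 hq
    obtain ⟨d, rfl⟩ := QuotientGroup.mk'_surjective M d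
    obtain ⟨c, hc, hcd⟩ := exists_mem_pow_of_index_le h1 hinv hgen hM.normal hM0 hMm d
    have hcd' : QuotientGroup.mk' M c = QuotientGroup.mk' M d := QuotientGroup.eq.2 hcd
    exact ⟨_, ⟨c, hc, u, Or.inr (Or.inl rfl), rfl⟩, by simp only [map_mul, map_inv, hcd']⟩
  obtain ⟨b, hb, hbx⟩ := exists_mem_pow_of_quotient (set_pow_eq_univ_of_card_le (one_mem_image _ h1C)
    (image_inv_eq _ hCinv) hCgen hMm) x
  refine ⟨b, ?_, hbx, fun N hN ↦ set_pow_subset_subgroup ?_ m hb⟩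
  · rw [pow_mul]
    refine Set.pow_subset_pow_left ?_ hb
    rintro _ ⟨c, hc, v, hv, rfl⟩
    have hvY : v ∈ Y ^ (8 ^ t * m ^ 2) := by
      rcases hv with rfl | rfl | rfl
      · exact Set.one_mem_pow h1
      · exact hu
      · exact inv_mem_set_pow hinv hu
    rw [show 2 * m + 8 ^ t * m ^ 2 = m + 8 ^ t * m ^ 2 + m by ring, pow_add, pow_add]
    exact Set.mul_mem_mul (Set.mul_mem_mul hc hvY) (inv_mem_set_pow hinv hc)
  · rintro _ ⟨c, hc, v, hv, rfl⟩
    refine (hJ N hN).1.normal.conj_mem _ ?_ _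
    rcases hv with rfl | rfl | rfl
    · exact N.one_mem
    · exact huJ N hN
    · exact N.inv_mem (huJ N hN)

/-- The quotient by the intersection is abelian, of exponent dividing m! and order at most m^k <
2^(mk+1), so `set_pow_eq_univ_of_comm` applies. -/
lemma exists_short_of_abelian (h1 : 1 ∈ Y) (hgen : Subgroup.closure Y = ⊤)
    {m k : ℕ} (hm : 1 ≤ m) (J : Finset (Subgroup A))
    (hJ : ∀ N ∈ J, N.Normal ∧ N.index ≠ 0 ∧ N.index ≤ m) (hab : ∀ N ∈ J, ∀ x y : A, ⁅x, y⁆ ∈ N)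
    (hcard : J.card ≤ k) (x : A) :
    ∃ a ∈ Y ^ ((m * k + 1) * m.factorial), ∀ N ∈ J, a⁻¹ * x ∈ N := by
  set R : Subgroup A := ⨅ N : J, (N : Subgroup A) with hR
  have hRmem : ∀ z, z ∈ R ↔ ∀ N ∈ J, z ∈ N := fun z ↦ by
    rw [hR, Subgroup.mem_iInf]
    exact ⟨fun h N hN ↦ h ⟨N, hN⟩, fun h N ↦ h N N.2⟩
  have hRn : R.Normal := ⟨fun z hz g ↦ by
    rw [hRmem] at hz ⊢
    exact fun N hN ↦ (hJ N hN).1.conj_mem z (hz N hN) g⟩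
  have : R.FiniteIndex := Subgroup.finiteIndex_iInf fun N ↦ ⟨(hJ N.1 N.2).2.1⟩
  have hRindex : R.index ≤ m ^ k := by
    refine (Subgroup.index_iInf_le _).trans
      ((Finset.prod_le_pow_card _ _ m fun N _ ↦ (hJ N.1 N.2).2.2).trans ?_)
    rw [Finset.card_univ, Fintype.card_coe]
    exact Nat.pow_le_pow_right hm hcard
  let _ : CommGroup (A ⧸ R) :=
    { (inferInstance : Group (A ⧸ R)) with
      mul_comm := fun p q ↦ by
        obtain ⟨a, rfl⟩ := QuotientGroup.mk'_surjective R p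
        obtain ⟨b, rfl⟩ := QuotientGroup.mk'_surjective R q
        rw [← commutatorElement_eq_one_iff_mul_comm, ← map_commutatorElement, mk'_eq_one_iff,
          hRmem]
        exact fun N hN ↦ hab N hN a b }
  have hexp : ∀ q : A ⧸ R, q ^ m.factorial = 1 := fun q ↦ by
    obtain ⟨z, rfl⟩ := QuotientGroup.mk'_surjective R q
    refine (map_pow (QuotientGroup.mk' R) z _).symm.trans (mk'_eq_one_iff.2 ((hRmem _).2 ?_))
    intro N hN
    obtain ⟨hNn, hN0, hNm⟩ := hJ N hN
    obtain ⟨r, hr⟩ := Nat.dvd_factorial (Nat.pos_of_ne_zero hN0) hNm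
    rw [hr, pow_mul]
    exact N.pow_mem (N.pow_index_mem z) r
  have hlt : R.index < 2 ^ (m * k + 1) := by
    refine (hRindex.trans (Nat.pow_le_pow_left Nat.lt_two_pow_self.le k)).trans_lt ?_
    rw [← pow_mul]
    exact Nat.pow_lt_pow_right one_lt_two (Nat.lt_succ_self _)
  obtain ⟨a, ha, hax⟩ := exists_mem_pow_of_quotient (M := R) (set_pow_eq_univ_of_comm
    (one_mem_image _ h1) (closure_image_mk_eq_top hgen R) m.factorial_pos hexp hlt) x
  exact ⟨a, ha, (hRmem _).1 hax⟩

/-- Diameter bound for the quotient by an intersection of maximal normal subgroups. -/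
lemma exists_short_of_isMaximalNormal (h1 : 1 ∈ Y) (hinv : Y⁻¹ = Y)
    (hgen : Subgroup.closure Y = ⊤) {m t : ℕ} (hm : 1 ≤ m) (J : Finset (Subgroup A))
    (hJ : ∀ N ∈ J, IsMaximalNormal N ∧ N.index ≠ 0 ∧ N.index ≤ m)
    (hcard : J.card ≤ 2 ^ t) (x : A) :
    ∃ a ∈ Y ^ ((m * 2 ^ t + 1) * m.factorial + 2 ^ t * ((2 * m + 8 ^ t * m ^ 2) * m)),
      ∀ N ∈ J, a⁻¹ * x ∈ N := by
  classical
  set D₁ := (m * 2 ^ t + 1) * m.factorial with hD₁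
  set D₂ := (2 * m + 8 ^ t * m ^ 2) * m with hD₂
  -- The abelian quotients are matched first. Each nonabelian one then costs one correction, which
  -- disturbs none of the others.
  have key : ∀ s : Finset (Subgroup A), s ⊆ J.filter (fun N ↦ ∃ x y : A, ⁅x, y⁆ ∉ N) →
      ∃ a ∈ Y ^ (D₁ + s.card * D₂),
        (∀ N ∈ J, (∀ x y : A, ⁅x, y⁆ ∈ N) → a⁻¹ * x ∈ N) ∧ ∀ N ∈ s, a⁻¹ * x ∈ N := by
    intro s
    induction s using Finset.induction_on with
    | empty =>
      intro _
      obtain ⟨a, ha, hax⟩ := exists_short_of_abelian h1 hgen hm (k := 2 ^ t)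
        (J.filter fun N ↦ ∀ x y : A, ⁅x, y⁆ ∈ N)
        (fun N hN ↦ ⟨(hJ N (Finset.mem_filter.1 hN).1).1.normal,
          (hJ N (Finset.mem_filter.1 hN).1).2⟩) (fun N hN ↦ (Finset.mem_filter.1 hN).2)
        ((Finset.card_filter_le _ _).trans hcard) x
      exact ⟨a, by simpa using ha, fun N hN h ↦ hax N (Finset.mem_filter.2 ⟨hN, h⟩), by simp⟩
    | insert M s hMs ih =>
      intro hs
      obtain ⟨a, ha, hab, has⟩ := ih ((Finset.subset_insert M s).trans hs)
      obtain ⟨hMJ, hMna⟩ := Finset.mem_filter.1 (hs (Finset.mem_insert_self M s))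
      obtain ⟨b, hb, hbM, hbJ⟩ := exists_short_correction h1 hinv hgen (t := t) (hJ M hMJ).1
        (hJ M hMJ).2.1 (hJ M hMJ).2.2 hMna (J.erase M)
        (fun N hN ↦ hJ N (Finset.mem_of_mem_erase hN)) (Finset.notMem_erase M J)
        ((Finset.card_le_card (Finset.erase_subset _ _)).trans hcard) (a⁻¹ * x)
      have hmul : ∀ N ∈ J, N ≠ M → a⁻¹ * x ∈ N → (a * b)⁻¹ * x ∈ N := fun N hN hNM h ↦ by
        rw [mul_inv_rev, mul_assoc]
        exact N.mul_mem (N.inv_mem (hbJ N (Finset.mem_erase.2 ⟨hNM, hN⟩))) h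
      refine ⟨a * b, ?_, fun N hN h ↦ hmul N hN ?_ (hab N hN h), fun N hN ↦ ?_⟩
      · rw [Finset.card_insert_of_notMem hMs, add_one_mul, ← add_assoc, pow_add]
        exact Set.mul_mem_mul ha hb
      · rintro rfl
        obtain ⟨y, z, hyz⟩ := hMna
        exact hyz (h y z)
      · rcases Finset.mem_insert.1 hN with rfl | hN'
        · rwa [mul_inv_rev, mul_assoc]
        · exact hmul N (Finset.mem_filter.1 (hs hN)).1 (fun h ↦ hMs (h ▸ hN')) (has N hN')
  obtain ⟨a, ha, hab, has⟩ := key _ Finset.Subset.rfl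
  refine ⟨a, Set.pow_subset_pow_right h1 ?_ ha, fun N hN ↦ ?_⟩
  · gcongr
    exact (Finset.card_filter_le _ _).trans hcard
  · by_cases h : ∃ x y : A, ⁅x, y⁆ ∉ N
    · exact has N (Finset.mem_filter.2 ⟨hN, h⟩)
    · push Not at h
      exact hab N hN h

end MaximalNormal

/-! ### Descent through finite-index subgroups with short generators. -/

section Descent

variable {Γ : Type*} [Group Γ]

/-- The diameter bound of `exists_short_of_isMaximalNormal`. -/
def diamBound (m t : ℕ) : ℕ :=
  (m * 2 ^ t + 1) * m.factorial + 2 ^ t * ((2 * m + 8 ^ t * m ^ 2) * m)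

/-- One round of the descent: `K'` is the intersection, over the `N` in `S` not containing `K`, of a
maximal normal subgroup of `K` above N ∩ K. -/
lemma exists_smaller_subgroup {T : Set Γ} (h1 : 1 ∈ T) (hinv : T⁻¹ = T) {m t : ℕ} (hm : 1 ≤ m)
    (S : Finset (Subgroup Γ)) (hS : ∀ N ∈ S, N.Normal ∧ N.index ≠ 0 ∧ N.index ≤ m)
    (hcard : S.card ≤ 2 ^ t) {K : Subgroup Γ} (hKf : K.FiniteIndex) {l : ℕ}
    (hK : Subgroup.closure ((K : Set Γ) ∩ T ^ l) = K) :
    ∃ K' : Subgroup Γ, K' ≤ K ∧ K'.FiniteIndex ∧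
      Subgroup.closure ((K' : Set Γ) ∩ T ^ (l * (2 * diamBound m t + 1))) = K' ∧
      ∀ N ∈ S, ¬ K ≤ N → N.relIndex K' < N.relIndex K := by
  classical
  set Y : Set K := K.subtype ⁻¹' (T ^ l) with hY
  have h1Y : 1 ∈ Y := Set.one_mem_pow h1
  have hYinv : Y⁻¹ = Y := by
    have hsub : Y⁻¹ ⊆ Y := fun y hy ↦ by
      have := inv_mem_set_pow hinv hy
      simpa [hY] using this
    exact hsub.antisymm (by simpa using Set.inv_subset_inv.2 hsub)
  have hYim : K.subtype '' Y = (K : Set Γ) ∩ T ^ l := by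
    rw [hY, Set.image_preimage_eq_inter_range, Set.inter_comm]
    simp
  have hYgen : Subgroup.closure Y = ⊤ := by
    apply Subgroup.map_injective K.subtype_injective
    rw [MonoidHom.map_closure, hYim, hK, ← MonoidHom.range_eq_map, Subgroup.range_subtype]
  have hidx : ∀ N ∈ S, (N.subgroupOf K).index ≠ 0 ∧ (N.subgroupOf K).index ≤ m := by
    intro N hN
    obtain ⟨_, hN0, hNm⟩ := hS N hN
    have hle : N.relIndex K ≤ N.index := by
      have := Subgroup.relIndex_le_of_le_right (H := N) (le_top : K ≤ ⊤)
        (by rwa [Subgroup.relIndex_top_right])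
      rwa [Subgroup.relIndex_top_right] at this
    exact ⟨fun h ↦ hN0 (Subgroup.index_eq_zero_of_relIndex_eq_zero h), hle.trans hNm⟩
  have hex : ∀ N : Subgroup Γ, ∃ M : Subgroup K, N ∈ S → ¬ K ≤ N →
      IsMaximalNormal M ∧ N.subgroupOf K ≤ M := by
    intro N
    by_cases hN : N ∈ S ∧ ¬ K ≤ N
    · have hNn := (hS N hN.1).1
      obtain ⟨M, hM⟩ := exists_isMaximalNormal_ge (N := N.subgroupOf K) inferInstance
        (hidx N hN.1).1 (fun h ↦ hN.2 (Subgroup.subgroupOf_eq_top.1 h))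
      exact ⟨M, fun _ _ ↦ hM⟩
    · exact ⟨⊤, fun h h' ↦ absurd ⟨h, h'⟩ hN⟩
  choose f hf using hex
  set J : Finset (Subgroup K) := (S.filter fun N ↦ ¬ K ≤ N).image f with hJdef
  have hJ : ∀ M ∈ J, IsMaximalNormal M ∧ M.index ≠ 0 ∧ M.index ≤ m := by
    intro M hM
    obtain ⟨N, hN, rfl⟩ := Finset.mem_image.1 hM
    obtain ⟨hNS, hNK⟩ := Finset.mem_filter.1 hN
    obtain ⟨hmax, hle⟩ := hf N hNS hNK
    have : (N.subgroupOf K).FiniteIndex := ⟨(hidx N hNS).1⟩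
    have : (f N).FiniteIndex := Subgroup.finiteIndex_of_le hle
    exact ⟨hmax, Subgroup.FiniteIndex.index_ne_zero,
      (Subgroup.index_antitone hle).trans (hidx N hNS).2⟩
  have hJcard : J.card ≤ 2 ^ t :=
    Finset.card_image_le.trans ((Finset.card_filter_le _ _).trans hcard)
  set R : Subgroup K := ⨅ M : J, (M : Subgroup K) with hR
  have hRmem : ∀ z, z ∈ R ↔ ∀ M ∈ J, z ∈ M := fun z ↦ by
    rw [hR, Subgroup.mem_iInf]
    exact ⟨fun h N hN ↦ h ⟨N, hN⟩, fun h N ↦ h N N.2⟩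
  have hRf : R.FiniteIndex := Subgroup.finiteIndex_iInf fun M ↦ ⟨(hJ M.1 M.2).2.1⟩
  have hRgen := closure_inter_pow_eq h1Y hYinv hYgen (H := R) (D := diamBound m t) fun x ↦ by
    obtain ⟨a, ha, hax⟩ := exists_short_of_isMaximalNormal h1Y hYinv hYgen hm J hJ hJcard x
    exact ⟨a, ha, (hRmem _).2 hax⟩
  refine ⟨R.map K.subtype, Subgroup.map_subtype_le R, ⟨?_⟩, le_antisymm ?_ ?_, ?_⟩
  · rw [Subgroup.index_map_subtype]
    exact mul_ne_zero hRf.index_ne_zero hKf.index_ne_zero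
  · rw [Subgroup.closure_le]
    exact Set.inter_subset_left
  · conv_lhs => rw [← hRgen]
    rw [MonoidHom.map_closure]
    refine Subgroup.closure_mono ?_
    rintro _ ⟨z, ⟨hzR, hz⟩, rfl⟩
    refine ⟨⟨z, hzR, rfl⟩, ?_⟩
    have hz' : K.subtype z ∈ K.subtype '' (Y ^ (2 * diamBound m t + 1)) := ⟨z, hz, rfl⟩
    rw [Set.image_pow, hYim] at hz'
    rw [pow_mul]
    exact Set.pow_subset_pow_left Set.inter_subset_right hz'
  · intro N hN hNK
    obtain ⟨hmax, hle⟩ := hf N hN hNK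
    have hfJ : f N ∈ J := Finset.mem_image_of_mem f (Finset.mem_filter.2 ⟨hN, hNK⟩)
    have hRM : R ≤ f N := fun z hz ↦ (hRmem z).1 hz _ hfJ
    rw [← Subgroup.relIndex_comap]
    change (N.subgroupOf K).relIndex R < (N.subgroupOf K).index
    -- With M = `f N`: [R : N ∩ R] ≤ [M : N ∩ K] since R ≤ M, while [K : N ∩ K] = [M : N ∩ K][K : M]
    -- and [K : M] > 1.
    have hmul := Subgroup.relIndex_mul_index hle
    have hne := (hidx N hN).1
    rw [← hmul] at hne ⊢
    have h0 := left_ne_zero_of_mul hne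
    refine (Subgroup.relIndex_le_of_le_right hRM h0).trans_lt ?_
    have h2 : (f N).index ≠ 1 := fun h ↦ hmax.ne_top (Subgroup.index_eq_one.1 h)
    have h3 := right_ne_zero_of_mul hne
    exact lt_mul_of_one_lt_right (Nat.pos_of_ne_zero h0) (by omega)

/-- In an infinite group there is a short nontrivial element lying in all normal subgroups of
index at most `m`. -/
lemma exists_short_mem_of_index_le [Infinite Γ] {T : Set Γ} (h1 : 1 ∈ T) (hinv : T⁻¹ = T)
    (hgen : Subgroup.closure T = ⊤) {m t : ℕ} (hm : 1 ≤ m)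
    (S : Finset (Subgroup Γ)) (hS : ∀ N ∈ S, N.Normal ∧ N.index ≠ 0 ∧ N.index ≤ m)
    (hcard : S.card ≤ 2 ^ t) :
    ∃ g ∈ T ^ ((2 * diamBound m t + 1) ^ m), g ≠ 1 ∧ ∀ N ∈ S, g ∈ N := by
  have key : ∀ j : ℕ, ∃ K : Subgroup Γ, K.FiniteIndex ∧
      Subgroup.closure ((K : Set Γ) ∩ T ^ ((2 * diamBound m t + 1) ^ j)) = K ∧
      ∀ N ∈ S, K ≤ N ∨ N.relIndex K + j ≤ m := by
    intro j
    induction j with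
    | zero =>
      refine ⟨⊤, inferInstance, by simpa using hgen, fun N hN ↦ Or.inr ?_⟩
      rw [Subgroup.relIndex_top_right]
      exact (hS N hN).2.2
    | succ j ih =>
      obtain ⟨K, hKf, hK, hKS⟩ := ih
      obtain ⟨K', hle, hf, hgen', hlt⟩ := exists_smaller_subgroup h1 hinv hm S hS hcard hKf hK
      refine ⟨K', hf, by rwa [pow_succ], fun N hN ↦ ?_⟩
      by_cases h : K ≤ N
      · exact Or.inl (hle.trans h)
      · have := hlt N hN h
        have := (hKS N hN).resolve_left h
        exact Or.inr (by omega)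
  obtain ⟨K, hKf, hK, hKS⟩ := key m
  -- After `m` rounds the other alternative would force a relative index 0, impossible for `N` of
  -- finite index.
  have hKN : ∀ N ∈ S, K ≤ N := fun N hN ↦ (hKS N hN).resolve_right fun h ↦
    (hS N hN).2.1 (Subgroup.index_eq_zero_of_relIndex_eq_zero (H := N) (K := K) (by omega))
  have hbot : K ≠ ⊥ := by
    rintro rfl
    have := hKf.index_ne_zero
    rw [Subgroup.index_bot] at this
    exact this Nat.card_eq_zero_of_infinite
  obtain ⟨g, ⟨hgK, hgT⟩, hg⟩ : ∃ g ∈ (K : Set Γ) ∩ T ^ ((2 * diamBound m t + 1) ^ m), g ≠ 1 := by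
    by_contra! hcon
    exact hbot (by rw [← hK]; exact Subgroup.closure_eq_bot_iff.2 fun x hx ↦ hcon x hx)
  exact ⟨g, hgT, hg, fun N hN ↦ hKN N hN hgK⟩

end Descent

/-! ### Counting normal subgroups of bounded index; the (log n)^(1/3) bound. -/

section Counting

variable {Γ : Type*} [Group Γ]

/-- Regular action of Γ/N, with Γ/N embedded in `Fin m`. -/
lemma exists_hom_perm_ker_eq {N : Subgroup Γ} (hN : N.Normal) {m : ℕ} (h0 : N.index ≠ 0)
    (hm : N.index ≤ m) : ∃ φ : Γ →* Equiv.Perm (Fin m), φ.ker = N := by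
  have : N.FiniteIndex := ⟨h0⟩
  have := Fintype.ofFinite (Γ ⧸ N)
  obtain ⟨e⟩ : Nonempty ((Γ ⧸ N) ↪ Fin m) := Function.Embedding.nonempty_of_card_le (by
    rw [Fintype.card_fin, ← Nat.card_eq_fintype_card]
    exact hm)
  refine ⟨((Equiv.Perm.viaEmbeddingHom e).comp (MulAction.toPermHom (Γ ⧸ N) (Γ ⧸ N))).comp
    (QuotientGroup.mk' N), ?_⟩
  have hinj := (Equiv.Perm.viaEmbeddingHom_injective e).comp
    (MulAction.toPerm_injective (α := Γ ⧸ N) (β := Γ ⧸ N))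
  ext x
  rw [MonoidHom.mem_ker, ← mk'_eq_one_iff]
  exact map_eq_one_iff ((Equiv.Perm.viaEmbeddingHom e).comp
    (MulAction.toPermHom (Γ ⧸ N) (Γ ⧸ N))) hinj

/-- Each such subgroup is the kernel of a homomorphism to Sym(m), which is determined by its values
on `X`. -/
lemma card_normal_index_le {X : Finset Γ} (hX : Subgroup.closure (X : Set Γ) = ⊤) (m : ℕ) :
    ∃ S : Finset (Subgroup Γ), (∀ N, N ∈ S ↔ N.Normal ∧ N.index ≠ 0 ∧ N.index ≤ m) ∧
      S.card ≤ m.factorial ^ X.card := by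
  let P : Type _ := {N : Subgroup Γ // N.Normal ∧ N.index ≠ 0 ∧ N.index ≤ m}
  have hex : ∀ N : P, ∃ φ : Γ →* Equiv.Perm (Fin m), φ.ker = N.1 := fun N ↦
    exists_hom_perm_ker_eq N.2.1 N.2.2.1 N.2.2.2
  choose φ hφ using hex
  let F : P → (X → Equiv.Perm (Fin m)) := fun N x ↦ φ N x
  have hF : Function.Injective F := fun N N' h ↦ by
    have : φ N = φ N' := MonoidHom.eq_of_eqOn_dense hX fun x hx ↦ congrFun h ⟨x, hx⟩
    exact Subtype.ext (by rw [← hφ N, this, hφ N'])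
  have : Finite P := Finite.of_injective F hF
  have hcard := Nat.card_le_card_of_injective F hF
  have hfin : {N : Subgroup Γ | N.Normal ∧ N.index ≠ 0 ∧ N.index ≤ m}.Finite := this
  refine ⟨hfin.toFinset, fun N ↦ by simp, ?_⟩
  rw [← Set.ncard_eq_toFinset_card _ hfin]
  have hfun : Nat.card (X → Equiv.Perm (Fin m)) = m.factorial ^ X.card := by
    rw [Nat.card_fun, Nat.card_perm, Nat.card_fin, Nat.card_eq_fintype_card, Fintype.card_coe]
  exact hfun ▸ hcard

lemma wordBall_mul_mem {X : Finset Γ} {a b : ℕ} {g h : Γ} (hg : g ∈ wordBall X a)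
    (hh : h ∈ wordBall X b) : g * h ∈ wordBall X (a + b) := by
  obtain ⟨l, hl, hlX, rfl⟩ := hg
  obtain ⟨l', hl', hlX', rfl⟩ := hh
  refine ⟨l ++ l', by simp; omega, fun x hx ↦ ?_, List.prod_append⟩
  rcases List.mem_append.1 hx with h | h
  · exact hlX x h
  · exact hlX' x h

lemma wordBall_one_pow_subset (X : Finset Γ) (n : ℕ) : wordBall X 1 ^ n ⊆ wordBall X n := by
  induction n with
  | zero => exact fun x hx ↦ ⟨[], by simp, by simp, by simpa using (Set.mem_one.1 hx).symm⟩
  | succ n ih =>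
    rw [pow_succ]
    rintro _ ⟨a, ha, b, hb, rfl⟩
    exact wordBall_mul_mem (ih ha) hb

lemma wordBall_mono (X : Finset Γ) : Monotone (wordBall X) :=
  fun _ _ h _ ⟨l, hl, hlX⟩ ↦ ⟨l, hl.trans h, hlX⟩

lemma inv_wordBall (X : Finset Γ) (n : ℕ) : (wordBall X n)⁻¹ = wordBall X n := by
  have hsub : (wordBall X n)⁻¹ ⊆ wordBall X n := by
    rintro g ⟨l, hl, hlX, hg⟩
    refine ⟨(l.map (·⁻¹)).reverse, by simpa using hl, fun x hx ↦ ?_, ?_⟩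
    · simp only [List.mem_reverse, List.mem_map] at hx
      obtain ⟨y, hy, rfl⟩ := hx
      simpa using (hlX y hy).symm
    · rw [← List.prod_inv_reverse, hg, inv_inv]
  exact hsub.antisymm (by simpa using Set.inv_subset_inv.2 hsub)

lemma farb_mono (X : Finset Γ) : Monotone (farb X) :=
  fun _ _ h ↦ biSup_mono fun _ hg ↦ ⟨wordBall_mono X h hg.1, hg.2⟩

lemma two_mul_diamBound_add_one_le {m t : ℕ} (hm : m ≤ 2 ^ t) (hf : m.factorial ≤ 2 ^ t)
    (ht : 1 ≤ t) : 2 * diamBound m t + 1 ≤ 2 ^ (11 * t) := by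
  have h8 : 8 ^ t = (2 ^ t) ^ 3 := by rw [← pow_mul, mul_comm, pow_mul]; norm_num
  have hM : 2 ≤ 2 ^ t := Nat.le_self_pow (by omega) 2
  rw [diamBound, h8, mul_comm 11 t, pow_mul]
  generalize 2 ^ t = M at *
  generalize m.factorial = r at *
  calc 2 * ((m * M + 1) * r + M * ((2 * m + M ^ 3 * m ^ 2) * m)) + 1
      ≤ 2 * ((M * M + 1) * M + M * ((2 * M + M ^ 3 * M ^ 2) * M)) + 1 := by gcongr
    _ = 2 * M ^ 7 + 6 * M ^ 3 + 2 * M ^ 1 + M ^ 0 := by ring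
    _ ≤ 2 * M ^ 7 + 6 * M ^ 7 + 2 * M ^ 7 + M ^ 7 := by gcongr <;> omega
    _ ≤ 2 ^ 4 * M ^ 7 := by omega
    _ ≤ M ^ 4 * M ^ 7 := by gcongr
    _ = M ^ 11 := by ring

/-- The main lower bound, of order `(log n)^(1/3)`. -/
theorem succ_le_farb [Infinite Γ] {X : Finset Γ} (hX : Subgroup.closure (X : Set Γ) = ⊤) {m : ℕ}
    (hm : 1 ≤ m) : ((m + 1 : ℕ) : ℕ∞) ≤ farb X (2 ^ (11 * (X.card + 1) * m ^ 3)) := by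
  obtain ⟨S, hS, hScard⟩ := card_normal_index_le hX m
  -- Since m! ≤ 2^(m²), the factor |X| covers the count of subgroups; the extra 1 keeps m! ≤ 2^t
  -- even for empty `X`.
  set t := m ^ 2 * (X.card + 1) with ht
  have hmt : m ≤ t :=
    (Nat.le_self_pow two_ne_zero m).trans (Nat.le_mul_of_pos_right _ (Nat.succ_pos _))
  have hfac : m.factorial ≤ 2 ^ m ^ 2 := by
    refine (Nat.factorial_le_pow m).trans ?_
    rw [sq, pow_mul]
    exact Nat.pow_le_pow_left Nat.lt_two_pow_self.le m
  have hfac' : m.factorial ≤ 2 ^ t :=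
    hfac.trans (Nat.pow_le_pow_right two_pos (Nat.le_mul_of_pos_right _ (Nat.succ_pos _)))
  have hcard : S.card ≤ 2 ^ t := by
    refine hScard.trans ((Nat.pow_le_pow_left hfac _).trans ?_)
    rw [← pow_mul]
    exact Nat.pow_le_pow_right two_pos (Nat.mul_le_mul_left _ (Nat.le_succ _))
  have h1 : (1 : Γ) ∈ wordBall X 1 := ⟨[], by simp, by simp, rfl⟩
  have hgen : Subgroup.closure (wordBall X 1) = ⊤ := by
    refine top_le_iff.1 (hX ▸ Subgroup.closure_mono fun x hx ↦ ?_)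
    exact ⟨[x], by simp, by simpa using Or.inl hx, by simp⟩
  obtain ⟨g, hg, hg1, hgS⟩ := exists_short_mem_of_index_le h1 (inv_wordBall X 1) hgen hm S
    (fun N hN ↦ (hS N).1 hN) hcard
  have hlen : (2 * diamBound m t + 1) ^ m ≤ 2 ^ (11 * (X.card + 1) * m ^ 3) := by
    refine (Nat.pow_le_pow_left (two_mul_diamBound_add_one_le
      (hmt.trans Nat.lt_two_pow_self.le) hfac' (hm.trans hmt)) m).trans (le_of_eq ?_)
    rw [← pow_mul, ht]
    ring_nf
  have hgB := wordBall_mono X hlen (wordBall_one_pow_subset X _ hg)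
  refine le_trans ?_ (le_iSup₂ (f := fun g (_ : g ∈ wordBall X _ \ {1}) ↦ normalDivisibility g)
    g ⟨hgB, hg1⟩)
  refine le_iInf fun Δ ↦ le_iInf fun hΔ ↦ le_iInf fun hgΔ ↦ ?_
  -- A normal subgroup of index at most `m` belongs to `S`, hence contains `g`.
  by_contra! hlt
  have hfin : Finite (Γ ⧸ Δ) := ENat.card_lt_top.1 (hlt.trans (ENat.natCast_lt_top _))
  rw [ENat.card_eq_coe_natCard, Nat.cast_lt] at hlt
  exact hgΔ (hgS Δ ((hS Δ).2 ⟨hΔ, Nat.card_pos.ne', Nat.lt_succ_iff.1 hlt⟩))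

end Counting

/-! ### Comparison with e^√(log log n). -/

section Growth

lemma exp_sqrt_log_log_le {a m n : ℕ} (ha : 1 ≤ a) (hn : 1 ≤ n)
    (hlt : n ≤ 2 ^ (a * (m + 1) ^ 3)) :
    Real.exp (Real.sqrt (Real.log (Real.log n))) ≤ 27 * a * (m + 1) := by
  have ha' : (1 : ℝ) ≤ a := by exact_mod_cast ha
  have hm' : (1 : ℝ) ≤ m + 1 := by linarith [(Nat.cast_nonneg m : (0 : ℝ) ≤ m)]
  -- For n = 1, 2 the default values of `Real.log` and `Real.sqrt` make the left side 1.
  rcases le_or_gt (Real.log (Real.log n)) 0 with h | h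
  · rw [Real.sqrt_eq_zero_of_nonpos h, Real.exp_zero]
    nlinarith
  have hlog0 : 0 ≤ Real.log n := Real.log_nonneg (by exact_mod_cast hn)
  have hlogpos : 0 < Real.log n := lt_of_le_of_ne hlog0 fun h0 ↦ by
    rw [← h0, Real.log_zero] at h
    exact lt_irrefl _ h
  have hlogle : Real.log n ≤ a * (m + 1) ^ 3 := by
    have h1 : (n : ℝ) ≤ 2 ^ (a * (m + 1) ^ 3) := by exact_mod_cast hlt
    have h2 := Real.log_le_log (by exact_mod_cast hn) h1
    rw [Real.log_pow] at h2
    push_cast at h2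
    refine h2.trans (mul_le_of_le_one_right (by positivity) ?_)
    linarith [Real.log_two_lt_d9]
  set s := Real.sqrt (Real.log (Real.log n)) with hs
  have hsq : s ^ 2 = Real.log (Real.log n) := Real.sq_sqrt h.le
  have hexp3 : Real.exp 3 ≤ 27 := by
    have h1 : Real.exp 3 = Real.exp 1 ^ 3 := by
      rw [← Real.exp_nat_mul]
      norm_num
    have h2 : Real.exp 1 ≤ 3 := by linarith [Real.exp_one_lt_d9]
    rw [h1]
    calc Real.exp 1 ^ 3 ≤ 3 ^ 3 := by gcongr
      _ = 27 := by norm_num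
  refine le_of_pow_le_pow_left₀ three_ne_zero (by positivity) ?_
  calc Real.exp s ^ 3 = Real.exp (3 * s) := by
        rw [← Real.exp_nat_mul]
        norm_num
    _ ≤ Real.exp (Real.log (Real.log n) + 3) := by
        gcongr
        -- 3s ≤ s² + 3, where s² = log log n.
        nlinarith [sq_nonneg (s - 3 / 2)]
    _ = Real.log n * Real.exp 3 := by rw [Real.exp_add, Real.exp_log hlogpos]
    _ ≤ (a * (m + 1) ^ 3) * 27 := by gcongr
    _ = (27 * a) * (m + 1) ^ 3 := by ring
    _ ≤ (27 * a) ^ 3 * (m + 1) ^ 3 := by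
        gcongr
        exact le_self_pow₀ (by linarith) three_ne_zero
    _ = (27 * a * (m + 1)) ^ 3 := by ring

variable {Γ : Type*} [Group Γ]

/-- A lower bound for `farb` in a form suited to comparison with `exp (√(log log n))`. -/
lemma exists_le_farb [Infinite Γ] {X : Finset Γ} (hX : Subgroup.closure (X : Set Γ) = ⊤) :
    ∃ a : ℕ, 1 ≤ a ∧ ∀ N : ℕ, 2 ^ a ≤ N → ∃ m : ℕ, ((m + 1 : ℕ) : ℕ∞) ≤ farb X N ∧
      ∀ n : ℕ, 1 ≤ n → n ≤ N →
        Real.exp (Real.sqrt (Real.log (Real.log n))) ≤ 27 * a * (m + 1) := by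
  refine ⟨11 * (X.card + 1), by omega, fun N hN ↦ ?_⟩
  set a := 11 * (X.card + 1) with ha
  have ha1 : 1 ≤ a := by omega
  have hex : ∃ k, N ≤ 2 ^ (a * (k + 1) ^ 3) := by
    refine ⟨N, Nat.lt_two_pow_self.le.trans (Nat.pow_le_pow_right two_pos ?_)⟩
    calc N ≤ N + 1 := N.le_succ
      _ ≤ (N + 1) ^ 3 := Nat.le_self_pow three_ne_zero _
      _ ≤ a * (N + 1) ^ 3 := Nat.le_mul_of_pos_left _ ha1
  classical
  -- Minimality gives 2^(a m³) < N when m > 0, so `succ_le_farb` applies at `m`; when m = 0 the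
  -- assumption 2^a ≤ N allows 1 instead.
  obtain ⟨m, hm, hmin⟩ : ∃ m, N ≤ 2 ^ (a * (m + 1) ^ 3) ∧
      ∀ k < m, ¬ N ≤ 2 ^ (a * (k + 1) ^ 3) :=
    ⟨Nat.find hex, Nat.find_spec hex, fun _ ↦ Nat.find_min hex⟩
  rcases Nat.eq_zero_or_pos m with rfl | hm0
  · refine ⟨1, (succ_le_farb hX le_rfl).trans (farb_mono X (by simpa using hN)), fun n hn hnN ↦ ?_⟩
    refine exp_sqrt_log_log_le ha1 hn (hnN.trans (hm.trans ?_))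
    exact Nat.pow_le_pow_right two_pos (Nat.mul_le_mul_left _ (by norm_num))
  · refine ⟨m, (succ_le_farb hX hm0).trans (farb_mono X ?_), fun n hn hnN ↦
      exp_sqrt_log_log_le ha1 hn (hnN.trans hm)⟩
    have := hmin (m - 1) (by omega)
    rw [Nat.sub_add_cancel hm0] at this
    exact (not_le.1 this).le

theorem growthLE_farb [Infinite Γ] {X : Finset Γ} (hX : Subgroup.closure (X : Set Γ) = ⊤) :
    GrowthLE
      (fun n : ℕ => ENNReal.ofReal (Real.exp (Real.sqrt (Real.log (Real.log (n : ℝ))))))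
      (fun n : ℕ => ((farb X n : ℕ∞) : ℝ≥0∞)) := by
  obtain ⟨a, ha, h⟩ := exists_le_farb hX
  -- 27a is the multiplicative loss; 2^a pushes the argument past the threshold of `exists_le_farb`.
  refine ⟨27 * a * 2 ^ a, by positivity, fun n hn ↦ ?_⟩
  have hpos : 0 < 2 ^ a := by positivity
  obtain ⟨m, hm, hle⟩ := h (27 * a * 2 ^ a * n)
    ((Nat.le_mul_of_pos_left _ (by positivity)).trans (Nat.le_mul_of_pos_right _ hn))
  have hm' : ((m + 1 : ℕ) : ℝ≥0∞) ≤ (farb X (27 * a * 2 ^ a * n) : ℝ≥0∞) := by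
    exact_mod_cast ENat.toENNReal_le.2 hm
  calc ENNReal.ofReal (Real.exp (Real.sqrt (Real.log (Real.log (n : ℝ)))))
      ≤ ENNReal.ofReal ((27 * a * (m + 1) : ℕ) : ℝ) := by
        refine ENNReal.ofReal_le_ofReal ?_
        push_cast
        exact hle n hn (Nat.le_mul_of_pos_left _ (by positivity))
    _ = ((27 * a : ℕ) : ℝ≥0∞) * ((m + 1 : ℕ) : ℝ≥0∞) := by
        rw [ENNReal.ofReal_natCast, Nat.cast_mul]
    _ ≤ ((27 * a * 2 ^ a : ℕ) : ℝ≥0∞) * (farb X (27 * a * 2 ^ a * n) : ℝ≥0∞) := by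
        exact mul_le_mul' (Nat.cast_le.2 (Nat.le_mul_of_pos_right _ hpos)) hm'

theorem limsup_farb_ne_zero [Infinite Γ] {X : Finset Γ}
    (hX : Subgroup.closure (X : Set Γ) = ⊤) :
    Filter.limsup (fun n : ℕ =>
      (ENNReal.log ((farb X n : ℕ∞) : ℝ≥0∞)) ^ 2 /
        ((Real.log (Real.log (n : ℝ)) : ℝ) : EReal)) Filter.atTop ≠ 0 := by
  obtain ⟨a, ha, h⟩ := exists_le_farb hX
  have hlim : Filter.Tendsto (fun n : ℕ ↦ Real.log (Real.log (n : ℝ))) Filter.atTop Filter.atTop :=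
    Real.tendsto_log_atTop.comp (Real.tendsto_log_atTop.comp tendsto_natCast_atTop_atTop)
  set b := Real.log (27 * a) with hb
  -- Once √(log log n) ≥ 2b, log F(n) is at least half of √(log log n); squaring gives 1/4.
  have hev : ∀ᶠ n : ℕ in Filter.atTop, ((1 / 4 : ℝ) : EReal) ≤
      (ENNReal.log ((farb X n : ℕ∞) : ℝ≥0∞)) ^ 2 /
        ((Real.log (Real.log (n : ℝ)) : ℝ) : EReal) := by
    filter_upwards [hlim.eventually_ge_atTop 1, hlim.eventually_ge_atTop ((2 * b) ^ 2),
      Filter.eventually_ge_atTop (2 ^ a)] with n hn1 hnb hna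
    obtain ⟨m, hm, hle⟩ := h n hna
    have hle := hle n (Nat.one_le_two_pow.trans hna) le_rfl
    set x := Real.log (Real.log (n : ℝ)) with hx
    have hm0 : (0 : ℝ) < m + 1 := by positivity
    have ha0 : (0 : ℝ) < 27 * a := by
      have : (1 : ℝ) ≤ a := by exact_mod_cast ha
      linarith
    have hs : Real.sqrt x ≤ b + Real.log (m + 1) := by
      rw [hb, ← Real.log_mul ha0.ne' hm0.ne']
      exact (Real.le_log_iff_exp_le (mul_pos ha0 hm0)).2 hle
    have hs2 : 2 * b ≤ Real.sqrt x := Real.le_sqrt_of_sq_le hnb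
    have hl : Real.sqrt x / 2 ≤ Real.log (m + 1) := by linarith
    have hlog : ((Real.sqrt x / 2 : ℝ) : EReal) ≤ ENNReal.log ((farb X n : ℕ∞) : ℝ≥0∞) := by
      have hm' : ((m + 1 : ℕ) : ℝ≥0∞) ≤ (farb X n : ℝ≥0∞) := by
        exact_mod_cast ENat.toENNReal_le.2 hm
      refine le_trans ?_ (ENNReal.log_monotone hm')
      rw [← ENNReal.ofReal_natCast, ENNReal.log_ofReal_of_pos (by positivity)]
      exact_mod_cast hl
    rw [EReal.le_div_iff_mul_le (by exact_mod_cast zero_lt_one.trans_le hn1) (EReal.coe_ne_top _)]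
    have h0 : (0 : EReal) ≤ ((Real.sqrt x / 2 : ℝ) : EReal) := by
      exact_mod_cast (by positivity : (0 : ℝ) ≤ Real.sqrt x / 2)
    calc ((1 / 4 : ℝ) : EReal) * (x : EReal)
        = ((Real.sqrt x / 2 : ℝ) : EReal) * ((Real.sqrt x / 2 : ℝ) : EReal) := by
          rw [← EReal.coe_mul, ← EReal.coe_mul]
          congr 1
          have := Real.mul_self_sqrt (zero_le_one.trans hn1)
          linarith
      _ ≤ _ := by
          rw [sq]
          exact mul_le_mul hlog hlog h0 (h0.trans hlog)
  have hlimsup := Filter.le_limsup_of_frequently_le hev.frequently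
  intro h0
  rw [h0] at hlimsup
  have : (1 / 4 : ℝ) ≤ 0 := by exact_mod_cast hlimsup
  norm_num at this

end Growth

theorem mainTheorem4 {Γ : Type*} [Group Γ] (X : Finset Γ)
    (hX : Subgroup.closure (X : Set Γ) = ⊤) :
    (Filter.limsup
        (fun n : ℕ =>
          (ENNReal.log ((farb X n : ℕ∞) : ℝ≥0∞)) ^ 2 /
            ((Real.log (Real.log (n : ℝ)) : ℝ) : EReal))
        Filter.atTop = 0 → Finite Γ) ∧
    (Infinite Γ →
      GrowthLE
        (fun n : ℕ => ENNReal.ofReal (Real.exp (Real.sqrt (Real.log (Real.log (n : ℝ))))))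
        (fun n : ℕ => ((farb X n : ℕ∞) : ℝ≥0∞))) := by
  refine ⟨fun h ↦ ?_, fun _ ↦ growthLE_farb hX⟩
  by_contra hfin
  have : Infinite Γ := not_finite_iff_infinite.1 hfin
  exact limsup_farb_ne_zero hX h
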